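/- Let $r,\ell\in\mathbb N$ with $r>\ell\ge 2$, let $\eta\in\left(0,\frac{r-\ell}{r}\right)$ and $\gamma\in\left(0,\frac{\ell-1}{\ell^2+2\ell}\right)$, and set $\mu:=\frac{r}{r-\ell}\left(\frac{r-\ell}{r}-\eta\right)$. For a finite graph $G$, write $\delta(G)$ for its minimum degree and $\alpha_\ell(G)$ for the maximum size of a set $S\subseteq V(G)$ such that the induced subgraph $G[S]$ contains no copy of the complete graph $K_\ell$; a $K_r$-tiling in $G$ is a collection of pairwise vertex-disjoint copies of $K_r$ in $G$. Then for all sufficiently large $n\in\mathbb N$ there exists an $n$-vertex graph $G$ with $\delta(G)\ge \eta n$ and $\alpha_\ell(G)<n^{1-\gamma}$ such that every $K_r$-tiling in $G$ covers at most $(1-\mu)n$ vertices. -/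

import Mathlib

/-- The `l`-independence number `α_l(G)` of a finite graph: the maximum size of a set of
vertices that contains no `l`-clique of `G`. -/
noncomputable def SimpleGraph.cliqueIndepNum {V : Type*} [Fintype V]
    (G : SimpleGraph V) (l : ℕ) : ℕ :=
  sSup {k : ℕ | ∃ s : Finset V, G.CliqueFreeOn (s : Set V) l ∧ s.card = k}

/-- For `l ≥ 1` the supremum in the definition is a maximum. -/
theorem SimpleGraph.isGreatest_cliqueIndepNum {V : Type*} [Fintype V]
    (G : SimpleGraph V) {l : ℕ} (hl : 1 ≤ l) :
    IsGreatest {k : ℕ | ∃ s : Finset V, G.CliqueFreeOn (s : Set V) l ∧ s.card = k}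
      (G.cliqueIndepNum l) := by
  have hb : BddAbove {k : ℕ | ∃ s : Finset V, G.CliqueFreeOn (s : Set V) l ∧ s.card = k} := by
    refine ⟨Fintype.card V, ?_⟩
    rintro k ⟨s, -, rfl⟩
    exact s.card_le_univ
  refine ⟨Nat.sSup_mem ⟨0, ∅, ?_, Finset.card_empty⟩ hb, fun k hk => le_csSup hb hk⟩
  rw [Finset.coe_empty, SimpleGraph.cliqueFreeOn_empty]
  omega

/-- A `K_r`-tiling in `G`: a collection of vertex-disjoint copies of `K_r` in `G`. Each copy is
given by its vertex set, which is an `r`-clique of `G`. -/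
def SimpleGraph.IsCliqueTiling {V : Type*} (G : SimpleGraph V) (r : ℕ)
    (T : Finset (Finset V)) : Prop :=
  (∀ K ∈ T, G.IsNClique r K) ∧ (T : Set (Finset V)).PairwiseDisjoint id

/-! Make a set `A` of `⌊ηn⌋` vertices universal and put on the rest a `K_{l+1}`-free graph `H` whose
`K_l`-free sets have size `O(n^{2/3})`. Every `K_r` then has at least `r - l` vertices in `A`, so a
tiling has at most `ηn/(r - l)` members and covers at most `rηn/(r - l) = (1 - μ)n` vertices. A
`K_l`-free set has fewer than `l` vertices in `A`, and `γ < 1/3` absorbs the rest. `H` lives on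
`𝔽_p³`. Any three directions `(1, t, t²)` are independent, so pairwise collinear points along such
directions lie on one line (`momentLine_triangle`). Colour each point `l` ways, independently on
each line through it, and join collinear points of different colours: cliques have at most `l`
vertices, and a union bound (`exists_coloring_forall_rainbow`) finds all colours on some line in
every set of `Kp²` points. -/

open Finset in
/-- If the union bound over all `k`-sets `S` and all choices of a missing colour on each block
succeeds, then some colouring of the flags makes every `k`-set meet some block in all colours. -/
theorem exists_coloring_forall_rainbow {T P L : Type*} [Fintype T] [Fintype P] [Fintype L]
    (f : T → P → L) {l : ℕ} (k : ℕ) (hl : 0 < l)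
    (h : (Fintype.card P) ^ k * l ^ (Fintype.card T * Fintype.card L) *
      (l - 1) ^ (Fintype.card T * k) < l ^ (Fintype.card T * k)) :
    ∃ c : T → P → Fin l, ∀ S : Finset P, S.card = k →
      ∃ t y, ∀ i, ∃ x ∈ S, f t x = y ∧ c t x = i := by
  classical
  by_contra! hcon
  have hk : k ≤ Fintype.card P := by
    obtain ⟨S, hS, -⟩ := hcon (fun _ _ => ⟨0, hl⟩)
    exact hS ▸ S.card_le_univ
  -- Once the missing colour of each block is fixed, the failing colourings form a product set,
  -- which can be counted exactly.
  let bad : Finset P × (T → L → Fin l) → Finset (T → P → Fin l) := fun q =>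
    Fintype.piFinset fun t => Fintype.piFinset fun x =>
      if x ∈ q.1 then {q.2 t (f t x)}ᶜ else univ
  have hbad : ∀ q ∈ powersetCard k (univ : Finset P) ×ˢ (univ : Finset (T → L → Fin l)),
      (bad q).card ≤ ((l - 1) ^ k * l ^ (Fintype.card P - k)) ^ Fintype.card T := by
    rintro ⟨S, g⟩ hq
    have hS : S.card = k := (mem_powersetCard.1 (mem_product.1 hq).1).2
    have hrow : ∀ t, (Fintype.piFinset fun x =>
        if x ∈ S then ({g t (f t x)}ᶜ : Finset (Fin l)) else univ).card =
        (l - 1) ^ k * l ^ (Fintype.card P - k) := by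
      intro t
      rw [Fintype.card_piFinset]
      have : ∀ x, (if x ∈ S then ({g t (f t x)}ᶜ : Finset (Fin l)) else univ).card =
          if x ∈ S then l - 1 else l := by
        intro x
        split_ifs <;> simp [card_compl]
      simp only [this, prod_ite, prod_const]
      congr 2
      · simp [hS]
      · rw [← hS, ← card_compl]
        congr 1
        ext x
        simp
    rw [Fintype.card_piFinset]
    simp only [hrow, prod_const, card_univ, le_refl]
  have hcover : (univ : Finset (T → P → Fin l)) ⊆
      (powersetCard k (univ : Finset P) ×ˢ (univ : Finset (T → L → Fin l))).biUnion bad := by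
    intro c _
    obtain ⟨S, hS, hmiss⟩ := hcon c
    choose g hg using hmiss
    rw [mem_biUnion]
    refine ⟨(S, g), mem_product.2 ⟨mem_powersetCard.2 ⟨subset_univ _, hS⟩, mem_univ _⟩, ?_⟩
    refine Fintype.mem_piFinset.2 fun t => Fintype.mem_piFinset.2 fun x => ?_
    dsimp only
    split_ifs with hx
    · simpa using hg t (f t x) x hx rfl
    · exact mem_univ _
  have hle := (card_le_card hcover).trans (card_biUnion_le_card_mul _ _ _ hbad)
  rw [card_product, card_powersetCard] at hle
  simp only [card_univ, Fintype.card_fun, Fintype.card_fin] at hle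
  set n := Fintype.card P
  set a := Fintype.card T
  set b := Fintype.card L
  have h1 : (l ^ n) ^ a = l ^ (a * k) * (l ^ (n - k)) ^ a := by
    rw [mul_comm a k, pow_mul, ← mul_pow, ← pow_add, Nat.add_sub_cancel' hk]
  have h2 : n.choose k * (l ^ b) ^ a * ((l - 1) ^ k * l ^ (n - k)) ^ a ≤
      (n ^ k * l ^ (a * b) * (l - 1) ^ (a * k)) * (l ^ (n - k)) ^ a := by
    rw [mul_pow, ← pow_mul (l - 1), mul_comm k a, ← pow_mul l b, mul_comm b a, ← mul_assoc]
    gcongr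
    exact Nat.choose_le_pow n k
  have h3 := Nat.mul_lt_mul_of_pos_right h (show 0 < (l ^ (n - k)) ^ a by positivity)
  rw [h1] at hle
  omega

/-! ### Lines along the moment curve and the coloured graph -/

/-- If the sides of a nondegenerate triangle in `F³` have directions `(1, tᵢ, tᵢ²)`, then the `tᵢ` are
equal: distinct directions on the moment curve are in general position. -/
theorem direction_eq_of_triangle {F : Type*} [Field F] {a b t₁ t₂ t₃ : F}
    (ha : a ≠ 0) (hb : b ≠ 0) (hab : a + b ≠ 0)
    (h₁ : a * t₁ + b * t₂ = (a + b) * t₃)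
    (h₂ : a * t₁ ^ 2 + b * t₂ ^ 2 = (a + b) * t₃ ^ 2) : t₁ = t₃ ∧ t₂ = t₃ := by
  -- Apply the weights `a`, `b`, `-(a + b)` to `(X - t₂)(X - t₃)` at `t₁`, `t₂`, `t₃`: only the
  -- first term survives.
  have key : a * ((t₁ - t₃) * (t₁ - t₂)) = 0 := by linear_combination h₂ - (t₂ + t₃) * h₁
  rcases mul_eq_zero.1 ((mul_eq_zero.1 key).resolve_left ha) with h | h
  · have h13 := sub_eq_zero.1 h
    subst h13
    have : b * (t₂ - t₁) = 0 := by linear_combination h₁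
    exact ⟨rfl, sub_eq_zero.1 ((mul_eq_zero.1 this).resolve_left hb)⟩
  · have h12 := sub_eq_zero.1 h
    subst h12
    have : (a + b) * (t₁ - t₃) = 0 := by linear_combination h₁
    have := sub_eq_zero.1 ((mul_eq_zero.1 this).resolve_left hab)
    exact ⟨this, this⟩

/-- The line with direction `(1, t, t²)` through a point of `F³`, given by its intersection with
the plane `x = 0`. -/
def momentLine {F : Type*} [Field F] (t : F) (x : F × F × F) : F × F :=
  (x.2.1 - t * x.1, x.2.2 - t ^ 2 * x.1)

theorem fst_ne_of_momentLine_eq {F : Type*} [Field F] {t : F} {x y : F × F × F} (hxy : x ≠ y)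
    (h : momentLine t x = momentLine t y) : y.1 - x.1 ≠ 0 := by
  obtain ⟨x₁, x₂, x₃⟩ := x
  obtain ⟨y₁, y₂, y₃⟩ := y
  simp only [momentLine, Prod.mk.injEq] at h
  intro h0
  have h1 : y₁ = x₁ := sub_eq_zero.1 h0
  subst h1
  exact hxy (by simpa using h)

theorem momentLine_triangle {F : Type*} [Field F] {t₁ t₂ t₃ : F} {x y z : F × F × F}
    (hxy : x ≠ y) (hyz : y ≠ z) (hxz : x ≠ z) (h₁ : momentLine t₁ x = momentLine t₁ y)
    (h₂ : momentLine t₂ y = momentLine t₂ z) (h₃ : momentLine t₃ x = momentLine t₃ z) :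
    t₁ = t₃ ∧ t₂ = t₃ := by
  have ha := fst_ne_of_momentLine_eq hxy h₁
  have hb := fst_ne_of_momentLine_eq hyz h₂
  have hc := fst_ne_of_momentLine_eq hxz h₃
  simp only [momentLine, Prod.mk.injEq] at h₁ h₂ h₃
  refine direction_eq_of_triangle ha hb (by convert hc using 1; ring) ?_ ?_
  · linear_combination h₁.1 + h₂.1 - h₃.1
  · linear_combination h₁.2 + h₂.2 - h₃.2

theorem direction_eq_of_momentLine_eq {F : Type*} [Field F] {t u : F} {x y : F × F × F}
    (hxy : x ≠ y) (h₁ : momentLine t x = momentLine t y) (h₂ : momentLine u x = momentLine u y) :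
    t = u := by
  have ha := fst_ne_of_momentLine_eq hxy h₁
  simp only [momentLine, Prod.mk.injEq] at h₁ h₂
  have : (y.1 - x.1) * (t - u) = 0 := by linear_combination h₁.1 - h₂.1
  exact sub_eq_zero.1 ((mul_eq_zero.1 this).resolve_left ha)

/-- Points of `F³` are adjacent if they are on a common line with direction `(1, t, t²)` that gives
them different colours. -/
def bichromaticGraph {F : Type*} [Field F] {l : ℕ} (c : F → F × F × F → Fin l) :
    SimpleGraph (F × F × F) where
  Adj x y := ∃ t, momentLine t x = momentLine t y ∧ c t x ≠ c t y
  symm := ⟨fun _ _ ⟨t, h, h'⟩ => ⟨t, h.symm, h'.symm⟩⟩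
  loopless := ⟨fun _ ⟨_, _, h⟩ => h rfl⟩

/-- Triangle rigidity puts a clique on the line through two of its points. Distinct points share
only one direction, so each edge must come from that line, and the colours there are distinct. -/
theorem bichromaticGraph_cliqueFree {F : Type*} [Field F] {l : ℕ} (hl : 2 ≤ l)
    (c : F → F × F × F → Fin l) : (bichromaticGraph c).CliqueFree (l + 1) := by
  intro s hs
  obtain ⟨x, hx, y, hy, hxy⟩ := Finset.one_lt_card.1 (show 1 < s.card by rw [hs.card_eq]; omega)
  obtain ⟨t, ht, -⟩ := hs.isClique hx hy hxy
  have hline : ∀ z ∈ s, momentLine t x = momentLine t z := by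
    intro z hz
    by_cases hxz : x = z
    · rw [hxz]
    by_cases hyz : y = z
    · rw [← hyz, ht]
    obtain ⟨t₂, ht₂, -⟩ := hs.isClique hy hz hyz
    obtain ⟨t₃, ht₃, -⟩ := hs.isClique hx hz hxz
    rw [(momentLine_triangle hxy hyz hxz ht ht₂ ht₃).1]
    exact ht₃
  have hinj : Set.InjOn (c t) s := by
    intro z hz w hw hc
    by_contra hzw
    obtain ⟨u, hu, hcu⟩ := hs.isClique hz hw hzw
    have := direction_eq_of_momentLine_eq hzw ((hline z hz).symm.trans (hline w hw)) hu
    exact hcu (this ▸ hc)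
  have := Finset.card_le_card_of_injOn (t := Finset.univ) (c t) (by simp) hinj
  rw [hs.card_eq, Finset.card_univ, Fintype.card_fin] at this
  omega

theorem bichromaticGraph_exists_clique {F : Type*} [Field F] {l : ℕ}
    (c : F → F × F × F → Fin l) {S : Finset (F × F × F)} {t : F} {y : F × F}
    (h : ∀ i, ∃ x ∈ S, momentLine t x = y ∧ c t x = i) :
    ∃ s ⊆ S, (bichromaticGraph c).IsNClique l s := by
  classical
  choose g hgS hgy hgc using h
  have hg : Function.Injective g := fun i j hij => by rw [← hgc i, ← hgc j, hij]
  refine ⟨Finset.univ.image g, ?_, ?_, ?_⟩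
  · intro x hx
    obtain ⟨i, -, rfl⟩ := Finset.mem_image.1 hx
    exact hgS i
  · intro x hx z hz hxz
    rw [Finset.mem_coe] at hx hz
    obtain ⟨i, -, rfl⟩ := Finset.mem_image.1 hx
    obtain ⟨j, -, rfl⟩ := Finset.mem_image.1 hz
    refine ⟨t, by rw [hgy, hgy], ?_⟩
    rw [hgc, hgc]
    rintro rfl
    exact hxz rfl
  · rw [Finset.card_image_of_injective _ hg, Finset.card_univ, Fintype.card_fin]

/-- For `2 ≤ l` and all large primes `p` the points of `𝔽_p³` carry a `K_{l+1}`-free graph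
whose `K_l`-free sets have size `O(p²)`. -/
theorem exists_cliqueFree_graph_zmod (l : ℕ) (hl : 2 ≤ l) :
    ∃ K : ℕ, ∀ᶠ p : ℕ in Filter.atTop, ∀ [Fact p.Prime],
      ∃ H : SimpleGraph (ZMod p × ZMod p × ZMod p), H.CliqueFree (l + 1) ∧
        ∀ S : Finset (ZMod p × ZMod p × ZMod p), H.CliqueFreeOn (S : Set _) l →
          S.card < K * p ^ 2 := by
  -- In the union bound `l` pays for the missing colours and `2` for the choice of the set.
  obtain ⟨K, hK⟩ : ∃ K : ℕ, 2 * l * (l - 1) ^ K ≤ l ^ K := by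
    have h1 : (1 : ℝ) < l / (l - 1) := by
      have : (2 : ℝ) ≤ l := by exact_mod_cast hl
      rw [lt_div_iff₀ (by linarith)]
      linarith
    obtain ⟨K, hK⟩ := pow_unbounded_of_one_lt (2 * l : ℝ) h1
    refine ⟨K, ?_⟩
    have h2 : (0 : ℝ) < (l : ℝ) - 1 := by
      have : (2 : ℝ) ≤ l := by exact_mod_cast hl
      linarith
    rw [div_pow, lt_div_iff₀ (by positivity)] at hK
    have : ((l - 1 : ℕ) : ℝ) = l - 1 := by
      rw [Nat.cast_sub (by omega), Nat.cast_one]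
    rw [← this] at hK
    exact_mod_cast hK.le
  refine ⟨K, ?_⟩
  have hgrow : ∀ᶠ p : ℕ in Filter.atTop, p ^ (3 * K) < 2 ^ p := by
    have := (isLittleO_pow_const_const_pow_of_one_lt (R := ℝ) (3 * K) one_lt_two).bound
      (show (0 : ℝ) < 1 / 2 by norm_num)
    filter_upwards [this] with p hp
    rw [Real.norm_of_nonneg (by positivity), Real.norm_of_nonneg (by positivity)] at hp
    have h2 : (0 : ℝ) < 2 ^ p := by positivity
    have : (p : ℝ) ^ (3 * K) < 2 ^ p := by linarith
    exact_mod_cast this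
  filter_upwards [hgrow] with p hp hprime
  have hp0 : p ≠ 0 := hprime.out.ne_zero
  obtain ⟨c, hc⟩ := exists_coloring_forall_rainbow (l := l) (momentLine (F := ZMod p)) (K * p ^ 2)
    (by omega) (by
      simp only [Fintype.card_prod, ZMod.card]
      -- This is the `p²`-th root of the required inequality.
      have hmain : p ^ (3 * K) * l ^ p * ((l - 1) ^ K) ^ p < (l ^ K) ^ p :=
        calc p ^ (3 * K) * l ^ p * ((l - 1) ^ K) ^ p
            < 2 ^ p * l ^ p * ((l - 1) ^ K) ^ p := by
              have : 0 < l - 1 := by omega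
              have : 0 < l := by omega
              gcongr
          _ = (2 * l * (l - 1) ^ K) ^ p := by rw [mul_pow, mul_pow]
          _ ≤ (l ^ K) ^ p := by gcongr
      have := Nat.pow_lt_pow_left hmain (show p ^ 2 ≠ 0 by positivity)
      convert this using 1
      · rw [show p * (p * p) = p ^ 3 by ring]
        simp only [mul_pow, ← pow_mul]
        congr 2 <;> ring_nf
      · simp only [← pow_mul]
        ring_nf)
  refine ⟨bichromaticGraph c, bichromaticGraph_cliqueFree hl c, fun S hS => ?_⟩
  by_contra! hcard
  obtain ⟨S', hS', hcard'⟩ := Finset.exists_subset_card_eq hcard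
  obtain ⟨t, y, h⟩ := hc S' hcard'
  obtain ⟨s, hs, hclique⟩ := bichromaticGraph_exists_clique c h
  exact hS (Finset.coe_subset.2 (hs.trans hS')) hclique

/-- An edge-maximal `K_{l+1}`-free graph with `l ≥ 2` has no isolated vertices. -/
theorem exists_adj_of_maximal_cliqueFree {W : Type*} [Nontrivial W] {H : SimpleGraph W} {l : ℕ}
    (hl : 2 ≤ l) (hH : Maximal (fun G : SimpleGraph W => G.CliqueFree (l + 1)) H) (v : W) :
    ∃ w, H.Adj v w := by
  classical
  by_contra! hv
  obtain ⟨w, hw⟩ := exists_ne v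
  have hfree : (H ⊔ SimpleGraph.edge v w).CliqueFree (l + 1) := by
    intro s hs
    have hadj : ∀ x ∈ s, ∀ y ∈ s, x ≠ y → H.Adj x y ∨ (x = v ∧ y = w) ∨ (x = w ∧ y = v) := by
      intro x hx y hy hxy
      have := hs.isClique hx hy hxy
      rw [SimpleGraph.sup_adj, SimpleGraph.edge_adj] at this
      tauto
    by_cases hvs : v ∈ s
    · obtain ⟨x, hx, hxvw⟩ : ∃ x ∈ s, x ∉ ({v, w} : Finset W) := by
        refine Finset.exists_mem_notMem_of_card_lt_card ?_
        rw [hs.card_eq]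
        exact Finset.card_le_two.trans_lt (by omega)
      simp only [Finset.mem_insert, Finset.mem_singleton, not_or] at hxvw
      have := hadj v hvs x hx (Ne.symm hxvw.1)
      have := hv x
      tauto
    · refine hH.prop s ⟨fun x hx y hy hxy => ?_, hs.card_eq⟩
      rw [Finset.mem_coe] at hx hy
      rcases hadj x hx y hy hxy with h | ⟨rfl, -⟩ | ⟨-, rfl⟩
      · exact h
      · exact absurd hx hvs
      · exact absurd hy hvs
  have hle := hH.le_of_ge hfree le_sup_left
  refine hv w (hle ?_)
  rw [SimpleGraph.sup_adj, SimpleGraph.edge_adj]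
  exact Or.inr ⟨Or.inl ⟨rfl, rfl⟩, hw.symm⟩

/-- An Erdős–Rogers type bound: there are `K_{l+1}`-free graphs without isolated vertices, on any
number of vertices, whose `K_l`-free sets have size `O(n^{2/3})`. -/
theorem exists_cliqueFree_graph_small_cliqueFreeOn (l : ℕ) (hl : 2 ≤ l) :
    ∃ C : ℝ, ∀ᶠ n : ℕ in Filter.atTop, ∀ (W : Type) [Fintype W] [Nontrivial W],
      Fintype.card W ≤ n → ∃ H : SimpleGraph W, H.CliqueFree (l + 1) ∧ (∀ v, ∃ w, H.Adj v w) ∧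
        ∀ S : Finset W, H.CliqueFreeOn (S : Set W) l →
          (S.card : ℝ) ≤ C * (n : ℝ) ^ (2 / 3 : ℝ) := by
  obtain ⟨K, hK⟩ := exists_cliqueFree_graph_zmod l hl
  obtain ⟨p₀, hp₀⟩ := Filter.eventually_atTop.1 hK
  refine ⟨16 * K, ?_⟩
  have hroot : Filter.Tendsto (fun n : ℕ => (n : ℝ) ^ (1 / 3 : ℝ)) Filter.atTop Filter.atTop :=
    (tendsto_rpow_atTop (by norm_num)).comp tendsto_natCast_atTop_atTop
  filter_upwards [hroot.eventually_ge_atTop (max p₀ 1)] with n hn W _ _ hW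
  set x : ℝ := (n : ℝ) ^ (1 / 3 : ℝ) with hx
  have hx1 : 1 ≤ x := (le_max_right _ _).trans hn
  have hx0 : (p₀ : ℝ) ≤ x := (le_max_left _ _).trans hn
  have hx3 : x ^ 3 = n := by
    rw [hx, ← Real.rpow_natCast, ← Real.rpow_mul (by positivity)]
    norm_num
  have hx2 : x ^ 2 = (n : ℝ) ^ (2 / 3 : ℝ) := by
    rw [hx, ← Real.rpow_natCast, ← Real.rpow_mul (by positivity)]
    norm_num
  have hxc : x ≤ (⌈x⌉₊ : ℝ) := Nat.le_ceil x
  have hcx : (⌈x⌉₊ : ℝ) < x + 1 := Nat.ceil_lt_add_one (by linarith)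
  -- Bertrand's postulate gives `x < p ≤ 4x`: enough points for `W`, and the constant `16 = 4²`.
  obtain ⟨p, hp, hlt, hle⟩ := Nat.exists_prime_lt_and_le_two_mul ⌈x⌉₊
    (Nat.ceil_pos.2 (by linarith)).ne'
  have hlt' : (⌈x⌉₊ : ℝ) < p := by exact_mod_cast hlt
  have hle' : (p : ℝ) ≤ 2 * ⌈x⌉₊ := by exact_mod_cast hle
  have : Fact p.Prime := ⟨hp⟩
  obtain ⟨H, hH, hS⟩ := hp₀ p (by
    have : (p₀ : ℝ) ≤ p := by linarith
    exact_mod_cast this)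
  have hcard : Fintype.card W ≤ Fintype.card (ZMod p × ZMod p × ZMod p) := by
    simp only [Fintype.card_prod, ZMod.card]
    refine hW.trans ?_
    have : (n : ℝ) ≤ p * (p * p) := by
      rw [← hx3, show (p : ℝ) * (p * p) = p ^ 3 by ring]
      gcongr
      linarith
    exact_mod_cast this
  obtain ⟨e⟩ := Function.Embedding.nonempty_of_card_le hcard
  -- Adding edges only removes `K_l`-free sets, and maximality excludes isolated vertices.
  obtain ⟨H', hle', hmax⟩ := (Set.toFinite
    {G : SimpleGraph W | G.CliqueFree (l + 1)}).exists_le_maximal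
    (show (H.comap e) ∈ {G : SimpleGraph W | G.CliqueFree (l + 1)} from
      hH.comap (SimpleGraph.Embedding.comap e H).isContained)
  refine ⟨H', hmax.prop, exists_adj_of_maximal_cliqueFree hl hmax, fun S hSfree => ?_⟩
  have hmap : H.CliqueFreeOn ((S.map e : Finset _) : Set _) l := by
    intro s hs hclique
    obtain ⟨u, hu, rfl⟩ := Finset.subset_map_iff.1 (Finset.coe_subset.1 hs)
    refine hSfree (Finset.coe_subset.2 hu) ⟨fun a ha b hb hab => hle' ?_, ?_⟩
    · exact hclique.isClique (by simpa using ha) (by simpa using hb) (e.injective.ne hab)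
    · rw [← hclique.card_eq, Finset.card_map]
  have hlt := hS _ hmap
  rw [Finset.card_map] at hlt
  have hlt' : (S.card : ℝ) < K * (p : ℝ) ^ 2 := by exact_mod_cast hlt
  have hp4 : (p : ℝ) ≤ 4 * x := by linarith
  calc (S.card : ℝ) ≤ K * (p : ℝ) ^ 2 := hlt'.le
    _ ≤ K * (4 * x) ^ 2 := by gcongr
    _ = 16 * K * (n : ℝ) ^ (2 / 3 : ℝ) := by rw [← hx2]; ring

/-! ### Adding universal vertices -/

/-- The graph on `V` obtained from a graph on the complement of `A` by making all vertices of `A`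
adjacent to all other vertices. -/
def joinUniversal {V : Type*} (A : Finset V) (H : SimpleGraph {v // v ∉ A}) : SimpleGraph V where
  Adj u v := u ≠ v ∧ ∀ (hu : u ∉ A) (hv : v ∉ A), H.Adj ⟨u, hu⟩ ⟨v, hv⟩
  symm := ⟨fun _ _ h => ⟨h.1.symm, fun hu hv => (h.2 hv hu).symm⟩⟩
  loopless := ⟨fun _ h => h.1 rfl⟩

section joinUniversal

variable {V : Type*} [DecidableEq V] {A : Finset V} {H : SimpleGraph {v // v ∉ A}}

theorem card_sdiff_lt_of_isClique_joinUniversal {k : ℕ} (hH : H.CliqueFree k) {s : Finset V}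
    (hs : (joinUniversal A H).IsClique (s : Set V)) : (s \ A).card < k := by
  by_contra! hcard
  refine SimpleGraph.CliqueFree.mono (m := k) hcard hH (s.subtype (· ∉ A)) ⟨?_, ?_⟩
  · intro x hx y hy hxy
    exact (hs (by simpa using hx) (by simpa using hy) (Subtype.coe_injective.ne hxy)).2 x.2 y.2
  · rw [Finset.card_subtype, Finset.sdiff_eq_filter]

theorem card_lt_of_cliqueFreeOn_joinUniversal {l : ℕ} {s : Finset V}
    (hs : (joinUniversal A H).CliqueFreeOn (s : Set V) l) : (s ∩ A).card < l := by
  by_contra! hcard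
  obtain ⟨t, ht, htl⟩ := Finset.exists_subset_card_eq hcard
  refine hs (Finset.coe_subset.2 (ht.trans Finset.inter_subset_left)) ⟨?_, htl⟩
  intro x hx y _ hxy
  exact ⟨hxy, fun h => absurd (Finset.mem_inter.1 (ht hx)).2 h⟩

theorem cliqueFreeOn_subtype_of_joinUniversal {l : ℕ} {s : Finset V}
    (hs : (joinUniversal A H).CliqueFreeOn (s : Set V) l) :
    H.CliqueFreeOn ((s.subtype (· ∉ A) : Finset _) : Set _) l := by
  intro t ht hclique
  refine hs (t := t.map (Function.Embedding.subtype _)) ?_ ⟨?_, ?_⟩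
  · intro x hx
    simp only [Finset.coe_map, Set.mem_image, Finset.mem_coe] at hx
    obtain ⟨y, hy, rfl⟩ := hx
    simpa using ht hy
  · intro x hx y hy hxy
    simp only [Finset.coe_map, Set.mem_image, Finset.mem_coe] at hx hy
    obtain ⟨x, hx, rfl⟩ := hx
    obtain ⟨y, hy, rfl⟩ := hy
    exact ⟨hxy, fun _ _ => hclique.isClique hx hy (fun h => hxy (congrArg Subtype.val h))⟩
  · rw [Finset.card_map, hclique.card_eq]

/-- The extra `1`, an `H`-neighbour for vertices outside `A`, makes up for the rounding in `⌊ηn⌋`.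
-/
theorem succ_card_le_minDegree_joinUniversal [Fintype V] [Nonempty V]
    [DecidableRel (joinUniversal A H).Adj] (hA : A.card + 2 ≤ Fintype.card V)
    (hH : ∀ v, ∃ w, H.Adj v w) : A.card + 1 ≤ (joinUniversal A H).minDegree := by
  refine SimpleGraph.le_minDegree_of_forall_le_degree _ _ fun v => ?_
  rw [← SimpleGraph.card_neighborFinset_eq_degree]
  by_cases hv : v ∈ A
  · have hsub : Finset.univ.erase v ⊆ (joinUniversal A H).neighborFinset v := by
      intro w hw
      rw [SimpleGraph.mem_neighborFinset]
      exact ⟨(Finset.ne_of_mem_erase hw).symm, fun h => absurd hv h⟩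
    have := Finset.card_le_card hsub
    rw [Finset.card_erase_of_mem (Finset.mem_univ v), Finset.card_univ] at this
    omega
  · obtain ⟨⟨w, hw⟩, hvw⟩ := hH ⟨v, hv⟩
    have hsub : insert w A ⊆ (joinUniversal A H).neighborFinset v := by
      intro x hx
      rw [SimpleGraph.mem_neighborFinset]
      rcases Finset.mem_insert.1 hx with rfl | hx
      · exact ⟨fun h => hvw.ne (Subtype.ext h), fun _ _ => hvw⟩
      · exact ⟨fun h => hv (h ▸ hx), fun _ h => absurd hx h⟩
    have := Finset.card_le_card hsub
    rwa [Finset.card_insert_of_notMem hw] at this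

/-- The tiles have disjoint traces on `A`, each of size at least `r - l`. -/
theorem mul_card_le_of_isCliqueTiling_joinUniversal {l r : ℕ} (hH : H.CliqueFree (l + 1))
    {T : Finset (Finset V)} (hT : (joinUniversal A H).IsCliqueTiling r T) :
    T.card * (r - l) ≤ A.card := by
  have hmeet : ∀ K ∈ T, r - l ≤ (K ∩ A).card := by
    intro K hK
    have h1 := card_sdiff_lt_of_isClique_joinUniversal hH (hT.1 K hK).isClique
    have h2 := Finset.card_sdiff_add_card_inter K A
    rw [(hT.1 K hK).card_eq] at h2
    omega
  calc T.card * (r - l) ≤ ∑ K ∈ T, (K ∩ A).card := by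
        rw [← smul_eq_mul]
        exact Finset.card_nsmul_le_sum _ _ _ hmeet
    _ = (T.biUnion (· ∩ A)).card := by
        refine (Finset.card_biUnion fun K hK K' hK' hne => ?_).symm
        exact (hT.2 hK hK' hne).mono Finset.inter_subset_left Finset.inter_subset_left
    _ ≤ A.card := Finset.card_le_card (Finset.biUnion_subset.2 fun _ _ => Finset.inter_subset_right)

end joinUniversal

/-! ### Choice of parameters -/

theorem proposition1p8 (r l : ℕ) (hl : 2 ≤ l) (hlr : l < r)
    (η γ : ℝ) (hη : η ∈ Set.Ioo (0 : ℝ) (((r : ℝ) - l) / r))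
    (hγ : γ ∈ Set.Ioo (0 : ℝ) (((l : ℝ) - 1) / ((l : ℝ) ^ 2 + 2 * l)))
    (μ : ℝ) (hμ : μ = (r : ℝ) / ((r : ℝ) - l) * (((r : ℝ) - l) / r - η)) :
    ∀ᶠ n : ℕ in Filter.atTop,
      ∃ (G : SimpleGraph (Fin n)) (_ : DecidableRel G.Adj),
        η * n ≤ (G.minDegree : ℝ) ∧
        (G.cliqueIndepNum l : ℝ) < (n : ℝ) ^ (1 - γ) ∧
        ∀ T : Finset (Finset (Fin n)), G.IsCliqueTiling r T →
          ((T.biUnion id).card : ℝ) ≤ (1 - μ) * n := by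
  have hl' : (2 : ℝ) ≤ l := by exact_mod_cast hl
  have hlr' : (l : ℝ) < r := by exact_mod_cast hlr
  have hη1 : η < 1 := hη.2.trans ((div_lt_one (by linarith)).2 (by linarith))
  have hγ3 : γ < 1 / 3 := by
    refine hγ.2.trans ?_
    rw [div_lt_div_iff₀ (by positivity) (by norm_num)]
    nlinarith
  obtain ⟨C, hC⟩ := exists_cliqueFree_graph_small_cliqueFreeOn l hl
  -- This leaves at least two vertices outside `A`, as `Nontrivial` demands.
  have hlarge : ∀ᶠ n : ℕ in Filter.atTop, 2 ≤ (1 - η) * (n : ℝ) :=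
    (Filter.Tendsto.const_mul_atTop (by linarith) tendsto_natCast_atTop_atTop).eventually_ge_atTop 2
  have hexp : Filter.Tendsto (fun n : ℕ => (n : ℝ) ^ (1 / 3 - γ)) Filter.atTop Filter.atTop :=
    (tendsto_rpow_atTop (by linarith)).comp tendsto_natCast_atTop_atTop
  filter_upwards [hC, hlarge, hexp.eventually_gt_atTop (C + l), Filter.eventually_ge_atTop 1]
    with n hn hn2 hnexp hn1
  have hn1' : (1 : ℝ) ≤ n := by exact_mod_cast hn1
  have hfloor : (⌊η * n⌋₊ : ℝ) ≤ η * n := Nat.floor_le (mul_nonneg hη.1.le (by positivity))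
  have hcard2 : ⌊η * n⌋₊ + 2 ≤ n := by
    have : ((⌊η * n⌋₊ + 2 : ℕ) : ℝ) ≤ n := by push_cast; linarith
    exact_mod_cast this
  obtain ⟨A, -, hA⟩ := Finset.exists_subset_card_eq (s := (Finset.univ : Finset (Fin n)))
    (n := ⌊η * n⌋₊) (by rw [Finset.card_univ, Fintype.card_fin]; omega)
  have hcardW : Fintype.card {v // v ∉ A} = n - ⌊η * n⌋₊ := by
    rw [Fintype.card_subtype_compl, Fintype.card_fin, Fintype.card_coe, hA]
  have : Nontrivial {v // v ∉ A} := Fintype.one_lt_card_iff_nontrivial.1 (by omega)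
  have : Nonempty (Fin n) := ⟨⟨0, by omega⟩⟩
  obtain ⟨H, hfree, hadj, hsmall⟩ := hn {v // v ∉ A} (by omega)
  refine ⟨joinUniversal A H, Classical.decRel _, ?_, ?_, fun T hT => ?_⟩
  · let _ := Classical.decRel (joinUniversal A H).Adj
    have h1 := succ_card_le_minDegree_joinUniversal (A := A) (H := H)
      (by rw [hA, Fintype.card_fin]; exact hcard2) hadj
    rw [hA] at h1
    refine (Nat.lt_floor_add_one (η * n)).le.trans ?_
    exact_mod_cast h1
  · obtain ⟨s, hs, hcard⟩ := ((joinUniversal A H).isGreatest_cliqueIndepNum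
      (show 1 ≤ l by omega)).1
    rw [← hcard]
    have h1 : ((s ∩ A).card : ℝ) ≤ l := by
      exact_mod_cast (card_lt_of_cliqueFreeOn_joinUniversal hs).le
    have h2 := hsmall _ (cliqueFreeOn_subtype_of_joinUniversal hs)
    rw [Finset.card_subtype, ← Finset.sdiff_eq_filter] at h2
    have h3 : ((s \ A).card : ℝ) + (s ∩ A).card = s.card := by
      exact_mod_cast Finset.card_sdiff_add_card_inter s A
    have h4 : (1 : ℝ) ≤ (n : ℝ) ^ (2 / 3 : ℝ) := Real.one_le_rpow hn1' (by norm_num)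
    calc (s.card : ℝ) ≤ C * (n : ℝ) ^ (2 / 3 : ℝ) + l * 1 := by linarith
      _ ≤ C * (n : ℝ) ^ (2 / 3 : ℝ) + l * (n : ℝ) ^ (2 / 3 : ℝ) := by gcongr
      _ = (C + l) * (n : ℝ) ^ (2 / 3 : ℝ) := by ring
      _ < (n : ℝ) ^ (1 / 3 - γ) * (n : ℝ) ^ (2 / 3 : ℝ) := by gcongr
      _ = (n : ℝ) ^ (1 - γ) := by
        rw [← Real.rpow_add (by linarith)]
        ring_nf
  · have h1 : ((T.card : ℝ)) * ((r : ℝ) - l) ≤ η * n := by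
      have := mul_card_le_of_isCliqueTiling_joinUniversal hfree hT
      rw [hA] at this
      have h2 : ((T.card * (r - l) : ℕ) : ℝ) ≤ ⌊η * n⌋₊ := by exact_mod_cast this
      rw [Nat.cast_mul, Nat.cast_sub hlr.le] at h2
      exact h2.trans hfloor
    have h2 : ((T.biUnion id).card : ℝ) ≤ T.card * r := by
      exact_mod_cast Finset.card_biUnion_le_card_mul T id r fun K hK => (hT.1 K hK).card_eq.le
    have hrl : (0 : ℝ) < (r : ℝ) - l := by linarith
    have hr : (r : ℝ) ≠ 0 := by linarith
    calc ((T.biUnion id).card : ℝ) ≤ T.card * r := h2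
      _ ≤ (η * n / ((r : ℝ) - l)) * r := by
        gcongr
        rwa [le_div_iff₀ hrl]
      _ = (1 - μ) * n := by
        rw [hμ]
        field_simp
        ring
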